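/- Let $\overline{\mathbb N}=\mathbb N\cup\{\infty\}$ be the one-point compactification of the discrete space $\mathbb N$, regarded as a computable metric space with dense set of points $\mathbb N$ and metric $d(x,y)=\left|\frac1{x+1}-\frac1{y+1}\right|$ (where $\frac1{\infty+1}=0$), and let $\mathcal M(\overline{\mathbb N})$ be the set of Borel probability measures on it. Equip $\mathcal M(\overline{\mathbb N})$ with the weak topology, given by the effective subbasis of the sets $\{\mu:\int f\,d\mu<r\}$ and $\{\mu:\int f\,d\mu>r\}$, where $r\in\mathbb Q$ and $f$ is a maximum of finitely many hat functions $y\mapsto\bigl|1-|d(y,u)-s|^+/\varepsilon\bigr|^+$ with $u\in\mathbb N$, $s\ge 0$ rational and $\varepsilon\in\{1,\frac12,\frac13,\dots\}$. A function $f:\overline{\mathbb N}\times\mathcal M(\overline{\mathbb N})\to[0,\infty]$, $(x,\mu)\mapsto f_\mu(x)$, is lower semicomputable if, uniformly in $q\in\mathbb Q$, the set $\{(x,\mu):f_\mu(x)>q\}$ is the union of a recursively enumerable family of sets $B\times V$, with $B$ a ball of rational radius centred in $\mathbb N$ and $V$ a finite intersection of subbasis sets. A uniform test is a lower semicomputable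 $f$ with $\int f_\mu(x)\,\mu(dx)\le 1$ for every $\mu$. A uniform test $\mathbf t$ is universal if for every uniform test $f$ there is a constant $c>0$ with $f_\mu(x)\le c\,\mathbf t_\mu(x)$ for all $x,\mu$. Given a universal uniform test $\mathbf t$, a measure $M\in\mathcal M(\overline{\mathbb N})$ is neutral if $\mathbf t_M(x)\le 1$ for all $x\in\overline{\mathbb N}$. A measure $\nu\in\mathcal M(\overline{\mathbb N})$ is upper (respectively lower) semicomputable over $\mathbb N$ if $\{(n,r)\in\mathbb N\times\mathbb Q:\nu(\{n\})<r\}$ (respectively $\{(n,r)\in\mathbb N\times\mathbb Q:r<\nu(\{n\})\}$) is recursively enumerable. **Theorem.** Let $\mathbf t$ be any universal uniform test over $\overline{\mathbb N}$. There is no neutral measure over $\overline{\mathbb N}$ that is upper semicomputable over $\mathbb N$, and there is no neutral measure over $\overline{\mathbb N}$ that is lower semicomputable over $\mathbb N$. Moreover, for every $\nu\in\mathcal M(\overline{\mathbb N})$ that is upper or lower semicomputable over $\mathbb N$, there is a uniform test $g$ with $\sup_{n\in\mathbb N}g_\nu(n)=\infty$. -/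

import Mathlib

open MeasureTheory Topology
open scoped ENNReal NNReal OnePoint

noncomputable section

namespace UniformTest

/-- The nonnegative rational number `a / (b + 1)` with code `(a, b)`. -/
def ratVal (q : ℕ × ℕ) : ℝ := (q.1 : ℝ) / ((q.2 : ℝ) + 1)

/-! ### Computable metric spaces -/

/-- The data `(X, d, D, α)` of a computable metric space on a metric space `X`: `X` is complete,
`pt` enumerates a dense set, and the distances `d (pt i) (pt j)` are computable reals, uniformly
in `i` and `j`. -/
structure ComputableMetricSpace (X : Type*) [MetricSpace X] where
  complete : CompleteSpace X
  pt : ℕ → X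
  dense : DenseRange pt
  computable_dist : ∃ g : ℕ × ℕ × ℕ → ℕ × ℕ, Computable g ∧
    ∀ i j k : ℕ, |dist (pt i) (pt j) - ratVal (g (i, j, k))| < 1 / ((k : ℝ) + 1)

section General

variable {X : Type*} [MetricSpace X] [MeasurableSpace X]

/-- The hat function `g_{u,r,ε}(y) = |1 - |d(y, u) - r|⁺ / ε|⁺` with `u = pt h.1`,
`r` the rational coded by `h.2.1`, and `ε = 1 / (h.2.2 + 1)`. -/
def hat (S : ComputableMetricSpace X) (h : ℕ × (ℕ × ℕ) × ℕ) (y : X) : ℝ :=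
  max 0 (1 - max 0 (dist y (S.pt h.1) - ratVal h.2.1) / (1 / ((h.2.2 : ℝ) + 1)))

/-- The maximum of finitely many hat functions (hat functions are nonnegative, so including
the constant `0` in the maximum changes nothing). -/
def hatMax (S : ComputableMetricSpace X) (l : List (ℕ × (ℕ × ℕ) × ℕ)) (y : X) : ℝ :=
  l.foldr (fun h m => max (hat S h y) m) 0

/-- Codes of subbasic open sets of the space of probability measures. -/
abbrev SubbasisCode : Type := Bool × List (ℕ × (ℕ × ℕ) × ℕ) × (ℕ × ℕ)

/-- The subbasic sets `{μ : μ f < r}` (tag `true`) and `{μ : μ f > r}` (tag `false`) of the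
weak topology, where `f` is a maximum of finitely many hat functions and `r` is rational. -/
def subbasicSet (S : ComputableMetricSpace X) (s : SubbasisCode) : Set (ProbabilityMeasure X) :=
  match s with
  | (true, l, r) => {μ | ∫ y, hatMax S l y ∂(μ : Measure X) < ratVal r}
  | (false, l, r) => {μ | ratVal r < ∫ y, hatMax S l y ∂(μ : Measure X)}

/-- Codes of basic open sets of `X × M(X)`: a centre and a rational radius of a ball of `X`,
and a finite list of subbasic sets of measures. -/
abbrev BasisCode : Type := (ℕ × (ℕ × ℕ)) × List SubbasisCode

/-- The basic open set of `X × M(X)` with code `b`: the product of a rational ball and a finite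
intersection of subbasic sets of measures. -/
def basicSet (S : ComputableMetricSpace X) (b : BasisCode) : Set (X × ProbabilityMeasure X) :=
  {p | p.1 ∈ Metric.ball (S.pt b.1.1) (ratVal b.1.2) ∧ ∀ s ∈ b.2, p.2 ∈ subbasicSet S s}

/-- `f : X × M(X) → [0, ∞]` is lower semicomputable: the sets `{(x, μ) : f x μ > q}` are,
uniformly in the rational number `q`, recursively enumerable unions of basic open sets.
(As `f ≥ 0`, the condition is trivial for negative `q`.) -/
def LowerSemicomputable (S : ComputableMetricSpace X)
    (f : X → ProbabilityMeasure X → ℝ≥0∞) : Prop :=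
  ∃ G : BasisCode × (ℕ × ℕ) → Prop, REPred G ∧
    ∀ (q : ℕ × ℕ) (x : X) (μ : ProbabilityMeasure X),
      ENNReal.ofReal (ratVal q) < f x μ ↔ ∃ b : BasisCode, G (b, q) ∧ (x, μ) ∈ basicSet S b

/-- A uniform test of randomness. -/
def IsUniformTest (S : ComputableMetricSpace X)
    (f : X → ProbabilityMeasure X → ℝ≥0∞) : Prop :=
  LowerSemicomputable S f ∧ ∀ μ : ProbabilityMeasure X, ∫⁻ x, f x μ ∂(μ : Measure X) ≤ 1

/-- A universal uniform test: it dominates every uniform test up to a constant factor. -/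
def IsUniversalUniformTest (S : ComputableMetricSpace X)
    (t : X → ProbabilityMeasure X → ℝ≥0∞) : Prop :=
  IsUniformTest S t ∧ ∀ f : X → ProbabilityMeasure X → ℝ≥0∞, IsUniformTest S f →
    ∃ c : ℝ≥0, 0 < c ∧ ∀ (x : X) (μ : ProbabilityMeasure X), f x μ ≤ c * t x μ

/-- A measure is neutral (for the universal uniform test `t`) if no point has test value
greater than `1`. -/
def IsNeutral (t : X → ProbabilityMeasure X → ℝ≥0∞) (M : ProbabilityMeasure X) : Prop :=
  ∀ x : X, t x M ≤ 1

end General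

/-! ### The compactified natural numbers -/

/-- The one-point compactification `ℕ ∪ {∞}` of the discrete space of natural numbers. -/
abbrev NBar : Type := OnePoint ℕ

instance instMeasurableSpaceNBar : MeasurableSpace NBar := borel NBar

instance instBorelSpaceNBar : BorelSpace NBar := ⟨rfl⟩

/-- The embedding `n ↦ 1 / (n + 1)`, `∞ ↦ 0` of `ℕ ∪ {∞}` into the real line. -/
def toReal (x : NBar) : ℝ := OnePoint.elim x (0 : ℝ) (fun n : ℕ => 1 / ((n : ℝ) + 1))

theorem toReal_infty : toReal ∞ = 0 := rfl

theorem toReal_coe (n : ℕ) : toReal (n : NBar) = 1 / ((n : ℝ) + 1) := rfl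

theorem toReal_injective : Function.Injective toReal := by
  intro x y h
  induction x using OnePoint.rec with
  | infty =>
    induction y using OnePoint.rec with
    | infty => rfl
    | coe m =>
      rw [toReal_infty, toReal_coe] at h
      have : (0 : ℝ) < 1 / ((m : ℝ) + 1) := by positivity
      linarith
  | coe n =>
    induction y using OnePoint.rec with
    | infty =>
      rw [toReal_infty, toReal_coe] at h
      have : (0 : ℝ) < 1 / ((n : ℝ) + 1) := by positivity
      linarith
    | coe m =>
      rw [toReal_coe, toReal_coe] at h
      have hn : ((n : ℝ) + 1) ≠ 0 := by positivity
      have hm : ((m : ℝ) + 1) ≠ 0 := by positivity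
      field_simp at h
      have h' : (n : ℝ) = m := by linarith
      rw [Nat.cast_injective h']

theorem isEmbedding_toReal : IsEmbedding toReal := by
  have hc : Continuous toReal := by
    rw [OnePoint.continuous_iff_from_nat]
    exact tendsto_one_div_add_atTop_nhds_zero_nat (𝕜 := ℝ)
  exact (hc.isClosedEmbedding toReal_injective).isEmbedding

/-- The metric `d(x, y) = |1 / (x + 1) - 1 / (y + 1)|` (with `1 / (∞ + 1) = 0`) on `ℕ ∪ {∞}`;
it induces the topology of the one-point compactification. -/
instance instMetricSpaceNBar : MetricSpace NBar := isEmbedding_toReal.comapMetricSpace toReal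

theorem dist_eq (x y : NBar) : dist x y = |toReal x - toReal y| := rfl

/-- The computable metric space `ℕ ∪ {∞}`, with the dense set of natural numbers. -/
def nbar : ComputableMetricSpace NBar where
  complete := inferInstance
  pt := fun n => (n : NBar)
  dense := OnePoint.denseRange_coe
  computable_dist := by
    refine ⟨fun p => ((p.1 - p.2.1) + (p.2.1 - p.1), p.1 * p.2.1 + p.1 + p.2.1), ?_, ?_⟩
    · apply Primrec.to_comp
      have h1 : Primrec fun p : ℕ × ℕ × ℕ => p.1 := Primrec.fst
      have h2 : Primrec fun p : ℕ × ℕ × ℕ => p.2.1 := Primrec.fst.comp Primrec.snd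
      exact (Primrec.nat_add.comp (Primrec.nat_sub.comp h1 h2) (Primrec.nat_sub.comp h2 h1)).pair
        (Primrec.nat_add.comp (Primrec.nat_add.comp (Primrec.nat_mul.comp h1 h2) h1) h2)
    · intro i j k
      have key : dist (i : NBar) (j : NBar) =
          ratVal ((i - j) + (j - i), i * j + i + j) := by
        rw [dist_eq, toReal_coe, toReal_coe]
        have hi : (0 : ℝ) < (i : ℝ) + 1 := by positivity
        have hj : (0 : ℝ) < (j : ℝ) + 1 := by positivity
        have e1 : 1 / ((i : ℝ) + 1) - 1 / ((j : ℝ) + 1) =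
            ((j : ℝ) - i) / (((i : ℝ) + 1) * ((j : ℝ) + 1)) := by
          field_simp
          ring
        have e2 : (((i - j) + (j - i) : ℕ) : ℝ) = |(j : ℝ) - i| := by
          rcases le_total i j with h | h
          · rw [Nat.sub_eq_zero_of_le h, zero_add, Nat.cast_sub h, abs_of_nonneg]
            exact sub_nonneg.2 (Nat.cast_le.2 h)
          · rw [Nat.sub_eq_zero_of_le h, add_zero, Nat.cast_sub h, abs_sub_comm, abs_of_nonneg]
            exact sub_nonneg.2 (Nat.cast_le.2 h)
        rw [e1, abs_div, abs_of_pos (mul_pos hi hj), ratVal, e2]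
        congr 1
        push_cast
        ring
      rw [key, sub_self, abs_zero]
      positivity

/-- `ν` is lower semicomputable over `ℕ`: the set of pairs `(n, r)` with `n ∈ ℕ`, `r` rational
and `r < ν(n)` is recursively enumerable (negative `r` satisfy the inequality trivially). -/
def LowerSemicomputableOnNat (ν : ProbabilityMeasure NBar) : Prop :=
  REPred fun p : ℕ × (ℕ × ℕ) => ratVal p.2 < (ν : Measure NBar).real {(p.1 : NBar)}

/-- `ν` is upper semicomputable over `ℕ`: the set of pairs `(n, r)` with `n ∈ ℕ`, `r` rational
and `ν(n) < r` is recursively enumerable (no negative `r` satisfies the inequality). -/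
def UpperSemicomputableOnNat (ν : ProbabilityMeasure NBar) : Prop :=
  REPred fun p : ℕ × (ℕ × ℕ) => (ν : Measure NBar).real {(p.1 : NBar)} < ratVal p.2

end UniformTest

end

/-! For a given `ν`, it suffices to build a uniform test `g` that is unbounded at `ν` along the
natural numbers. A universal test dominates `g` up to a finite factor, while neutrality of `ν` would
bound it at `ν` by that factor.

The test gives value `2 ^ k` to a point found by an effective search at level `k`, but only for
measures `μ` that give this point small mass, with tolerance `ε = 1 / (4 ^ (k + 2) + 1)`. The
restriction on `μ` makes the integral bound hold for every `μ`, and it is an open condition: points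
of `ℕ` are isolated, so their indicators are exactly hat functions.

If `ν` is upper semicomputable, the search looks for some `n` with `ν(n) < ε`, which exists by
pigeonhole (`exists_test_of_upperSemicomputable`).

If `ν` is lower semicomputable, small mass cannot be recognized directly. Let `y` be the mass of the
first `N = 4 ^ (k + 2) + 2` points. Given an integer `m` with `y < (m + 1) ε`, it is enough to find
`n < N` such that the other points together have mass greater than `(m - 1) ε`: then `ν(n) < 2ε`.
The correct `m` is not computable, so all values are tried, and the guess `m` is active only at
measures `μ` whose mass on the first `N` points lies in `((m - 1) ε, (m + 1) ε)`. At most two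
guesses are active at any `μ`, so level `k` costs at most `2 ^ k * 4ε`
(`exists_test_of_lowerSemicomputable`).

In both cases `exists_uniformization` makes each search return at most one point; otherwise the
masses of many candidates could add up. -/

noncomputable section

namespace UniformTest

/-! ### Recursively enumerable predicates -/

section Computability

variable {α β : Type*} [Primcodable α] [Primcodable β]

/-- A recursively enumerable predicate is the increasing union of uniformly decidable stages. -/
theorem exists_stages {p : α → Prop} (hp : REPred p) :
    ∃ E : ℕ × α → Bool, Computable E ∧ (∀ a, p a ↔ ∃ s, E (s, a) = true) ∧
      ∀ a s t, s ≤ t → E (s, a) = true → E (t, a) = true := by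
  obtain ⟨c, hc⟩ := Nat.Partrec.Code.exists_code.1 hp
  refine ⟨fun x => (Nat.Partrec.Code.evaln x.1 c (Encodable.encode x.2)).isSome, ?_, ?_, ?_⟩
  · exact (Primrec.option_isSome.comp (Nat.Partrec.Code.primrec_evaln.comp
      ((Primrec.fst.pair (Primrec.const c)).pair (Primrec.encode.comp Primrec.snd)))).to_comp
  · intro a
    have h : (c.eval (Encodable.encode a)).Dom ↔ p a := by
      rw [hc]
      simp [Part.assert, Part.bind]
    rw [← h, Part.dom_iff_mem]
    simp only [Nat.Partrec.Code.evaln_complete, Option.isSome_iff_exists, Option.mem_def]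
    exact exists_comm
  · intro a s t hst h
    obtain ⟨x, hx⟩ := Option.isSome_iff_exists.1 h
    exact Option.isSome_iff_exists.2 ⟨x, Nat.Partrec.Code.evaln_mono hst hx⟩

theorem rePred_exists_nat {p : α × ℕ → Bool} (hp : Computable p) :
    REPred fun a => ∃ n, p (a, n) = true := by
  have h : Partrec fun a => Nat.rfind fun n => (Part.some (p (a, n)) : Part Bool) :=
    Partrec.rfind (p := fun a n => (Part.some (p (a, n)) : Part Bool)) (Computable.partrec hp)
  refine h.dom_re.of_eq fun a => ?_
  exact Nat.rfind_dom'.trans (by simp)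

theorem rePred_comp {p : β → Prop} (hp : REPred p) {f : α → β} (hf : Computable f) :
    REPred fun a => p (f a) :=
  Partrec.comp hp hf

theorem rePred_and {p q : α → Prop} (hp : REPred p) (hq : REPred q) :
    REPred fun a => p a ∧ q a := by
  have h : Partrec fun a => (Part.assert (p a) fun _ => Part.some ()).bind
      fun _ => Part.assert (q a) fun _ => Part.some () :=
    Partrec.bind hp (Partrec.comp hq Computable.fst).to₂
  refine h.dom_re.of_eq fun a => ?_
  simp [Part.assert, Part.bind]

theorem rePred_or {p q : α → Prop} (hp : REPred p) (hq : REPred q) :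
    REPred fun a => p a ∨ q a := by
  obtain ⟨E, hE, hpE, -⟩ := exists_stages hp
  obtain ⟨F, hF, hqF, -⟩ := exists_stages hq
  have h : Computable fun x : α × ℕ => E (x.2, x.1) || F (x.2, x.1) :=
    Primrec.or.to_comp.comp (hE.comp (Computable.snd.pair Computable.fst))
      (hF.comp (Computable.snd.pair Computable.fst))
  refine (rePred_exists_nat h).of_eq fun a => ?_
  simp only [Bool.or_eq_true, exists_or, hpE, hqF]

theorem rePred_exists {p : α × β → Prop} (hp : REPred p) : REPred fun a => ∃ b, p (a, b) := by
  obtain ⟨E, hE, hpE, -⟩ := exists_stages hp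
  -- Dovetailing: a single number codes both the stage and the candidate witness.
  have hdec : Computable fun x : α × ℕ =>
      (Encodable.decode (α := ℕ × β) x.2).map fun y => E (y.1, (x.1, y.2)) :=
    Computable.option_map (Computable.decode.comp Computable.snd)
      (hE.comp ((Computable.fst.comp Computable.snd).pair
        ((Computable.fst.comp Computable.fst).pair (Computable.snd.comp Computable.snd)))).to₂
  refine (rePred_exists_nat (Computable.option_getD hdec (Computable.const false))).of_eq fun a => ?_
  simp only [hpE]
  constructor
  · rintro ⟨n, hn⟩
    rcases h : Encodable.decode (α := ℕ × β) n with _ | y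
    · simp [h] at hn
    · exact ⟨y.2, y.1, by simpa [h] using hn⟩
  · rintro ⟨b, s, h⟩
    exact ⟨Encodable.encode (s, b), by simp only [Encodable.encodek]; simpa using h⟩

/-- Uniformization of recursively enumerable relations by recursively enumerable partial
functions. -/
theorem exists_uniformization {p : α × ℕ → Prop} (hp : REPred p) :
    ∃ r : α × ℕ → Prop, REPred r ∧ (∀ x, r x → p x) ∧
      (∀ a m n, r (a, m) → r (a, n) → m = n) ∧ ∀ a n, p (a, n) → ∃ m, r (a, m) := by
  obtain ⟨E, hE, hpE, -⟩ := exists_stages hp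
  -- The number `k` codes a pair (stage, candidate). The least accepted `k` selects one candidate,
  -- and `r (a, n)` says that `n` is the one selected.
  let f : α → ℕ → Bool := fun a k => E (k.unpair.1, (a, k.unpair.2))
  have hf : Computable₂ f := by
    have hu : Computable fun x : α × ℕ => x.2.unpair :=
      Computable.unpair.comp Computable.snd
    exact hE.comp ((Computable.fst.comp hu).pair
      (Computable.fst.pair (Computable.snd.comp hu)))
  have hF : Partrec fun a => Nat.rfind fun n => (Part.some (f a n) : Part Bool) :=
    Partrec.rfind (p := fun a n => (Part.some (f a n) : Part Bool)) (Computable.partrec hf)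
  have hdom : Partrec fun x : α × ℕ => (Nat.rfind fun n => (Part.some (f x.1 n) : Part Bool)).bind
      fun k => bif k.unpair.2 == x.2 then Part.some () else Part.none := by
    refine Partrec.bind (hF.comp Computable.fst) ?_
    refine Partrec.cond (c := fun y : (α × ℕ) × ℕ => y.2.unpair.2 == y.1.2) ?_
      (Computable.const ()).partrec Partrec.none
    exact (Primrec.beq.comp (Primrec.snd.comp (Primrec.unpair.comp Primrec.snd))
      (Primrec.snd.comp Primrec.fst)).to_comp
  have key : ∀ x : α × ℕ, ((Nat.rfind fun n => (Part.some (f x.1 n) : Part Bool)).bind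
      fun k => bif k.unpair.2 == x.2 then Part.some () else Part.none).Dom ↔
      ∃ k ∈ Nat.rfind fun n => (Part.some (f x.1 n) : Part Bool), k.unpair.2 = x.2 := by
    intro x
    rw [Part.dom_iff_mem]
    constructor
    · rintro ⟨u, hu⟩
      obtain ⟨k, hk, hu⟩ := Part.mem_bind_iff.1 hu
      refine ⟨k, hk, ?_⟩
      by_contra hne
      simp [beq_eq_false_iff_ne.2 hne] at hu
    · rintro ⟨k, hk, h⟩
      exact ⟨(), Part.mem_bind_iff.2 ⟨k, hk, by simp [h]⟩⟩
  refine ⟨_, hdom.dom_re.of_eq key, ?_, ?_, ?_⟩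
  · rintro ⟨a, n⟩ ⟨k, hk, rfl⟩
    exact (hpE _).2 ⟨k.unpair.1, (Part.mem_some_iff.1 (Nat.rfind_spec hk)).symm⟩
  · rintro a m n ⟨k, hk, rfl⟩ ⟨l, hl, rfl⟩
    rw [Part.mem_unique hk hl]
  · intro a n h
    obtain ⟨s, hs⟩ := (hpE _).1 h
    obtain ⟨k, hk, -⟩ := Nat.rfind_min' (p := f a) (m := Nat.pair s n) (by simpa [f] using hs)
    exact ⟨_, k, hk, rfl⟩

theorem computable_sum_range {f : α × ℕ → ℕ} (hf : Computable f) {N : α → ℕ}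
    (hN : Computable N) : Computable fun a => ∑ i ∈ Finset.range (N a), f (a, i) := by
  have h : Computable fun a => Nat.rec (motive := fun _ => ℕ) 0 (fun i s => s + f (a, i)) (N a) :=
    Computable.nat_rec (h := fun a y => y.2 + f (a, y.1)) hN (Computable.const 0)
      (Primrec.nat_add.to_comp.comp (Computable.snd.comp Computable.snd)
        (hf.comp (Computable.fst.pair (Computable.fst.comp Computable.snd)))).to₂
  refine h.of_eq fun a => ?_
  induction N a with
  | zero => rfl
  | succ n ih => rw [Finset.sum_range_succ, ← ih]

theorem primrec_pow (b : ℕ) {f : α → ℕ} (hf : Primrec f) : Primrec fun a => b ^ f a := by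
  have h : Primrec fun n : ℕ => b ^ n := by
    refine (Primrec.nat_rec₁ (f := fun _ x => x * b) 1
      (Primrec.nat_mul.comp Primrec.snd (Primrec.const b)).to₂).of_eq fun n => ?_
    induction n with
    | zero => rfl
    | succ n ih => rw [pow_succ, ← ih]
  exact h.comp hf

end Computability

/-! ### Lower semicomputability of finite sums -/

theorem ratVal_nonneg (q : ℕ × ℕ) : 0 ≤ ratVal q := by unfold ratVal; positivity

theorem ratVal_lt_iff (q : ℕ × ℕ) (x : ℝ) : ratVal q < x ↔ (q.1 : ℝ) < ((q.2 : ℝ) + 1) * x := by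
  rw [ratVal, div_lt_iff₀' (by positivity)]

theorem lt_ratVal_iff (q : ℕ × ℕ) (x : ℝ) : x < ratVal q ↔ ((q.2 : ℝ) + 1) * x < q.1 := by
  rw [ratVal, lt_div_iff₀' (by positivity)]

/-- If all the `i < T` in a finite set satisfy `i + 1 < x`, then it has at most `x` elements. -/
theorem card_filter_le_of_succ_lt {T : ℕ} {x : ℝ} (hx : 0 ≤ x) {e : ℕ → Bool}
    (he : ∀ i, e i = true → (i : ℝ) + 1 < x) :
    (((Finset.range T).filter fun i => e i = true).card : ℝ) ≤ x := by
  have h : (Finset.range T).filter (fun i => e i = true) ⊆ Finset.range ⌊x⌋₊ := by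
    intro i hi
    refine Finset.mem_range.2 (Nat.lt_of_succ_le (Nat.le_floor ?_))
    push_cast
    exact (he i (Finset.mem_filter.1 hi).2).le
  calc _ ≤ ((⌊x⌋₊ : ℕ) : ℝ) := by
        exact_mod_cast (Finset.card_le_card h).trans (Finset.card_range _).le
    _ ≤ x := Nat.floor_le hx

theorem le_card_filter_of_succ_lt {T : ℕ} {x : ℝ} (hx : x ≤ T + 1) {e : ℕ → Bool}
    (he : ∀ i < T, (i : ℝ) + 1 < x → e i = true) :
    x - 1 ≤ (((Finset.range T).filter fun i => e i = true).card : ℝ) := by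
  have hT : ⌈x⌉₊ ≤ T + 1 := Nat.ceil_le.2 (by push_cast; exact hx)
  have h : Finset.range (⌈x⌉₊ - 1) ⊆ (Finset.range T).filter fun i => e i = true := by
    intro i hi
    have hi' := Finset.mem_range.1 hi
    have hiT : i < T := by omega
    refine Finset.mem_filter.2 ⟨Finset.mem_range.2 hiT, he i hiT ?_⟩
    have : i + 1 < ⌈x⌉₊ := by omega
    have := Nat.lt_ceil.1 this
    push_cast at this
    exact this
  have h1 : ⌈x⌉₊ ≤ ((Finset.range T).filter fun i => e i = true).card + 1 := by
    have := Finset.card_le_card h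
    rw [Finset.card_range] at this
    omega
  have h2 : ((⌈x⌉₊ : ℕ) : ℝ) ≤ ((Finset.range T).filter fun i => e i = true).card + 1 := by
    exact_mod_cast h1
  linarith [Nat.le_ceil x]

variable {α β : Type*} [Primcodable α] [Primcodable β]

/-- Finite sums of lower semicomputable functions are lower semicomputable. -/
theorem rePred_ratVal_lt_sum {φ : α → ℝ} (h0 : ∀ a, 0 ≤ φ a) (h1 : ∀ a, φ a ≤ 1)
    (hφ : REPred fun p : α × (ℕ × ℕ) => ratVal p.2 < φ p.1) {h : β × ℕ → α}
    (hh : Computable h) {N : β → ℕ} (hN : Computable N) :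
    REPred fun p : β × (ℕ × ℕ) => ratVal p.2 < ∑ j ∈ Finset.range (N p.1), φ (h (p.1, j)) := by
  obtain ⟨E, hE, hφE, hmono⟩ := exists_stages hφ
  -- The count of those fractions `(i + 1) / (T + 1)` with `i < T` confirmed to lie below `φ a` by
  -- stage `s`. It never exceeds `(T + 1) * φ a`, and for large `s` it falls short by at most `1`.
  let c : (ℕ × ℕ) × α → ℕ := fun x =>
    ∑ i ∈ Finset.range x.1.2, bif E (x.1.1, (x.2, (i + 1, x.1.2))) then 1 else 0
  have hc : Computable c := by
    refine computable_sum_range (f := fun y : ((ℕ × ℕ) × α) × ℕ =>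
      bif E (y.1.1.1, (y.1.2, (y.2 + 1, y.1.1.2))) then 1 else 0) ?_
      (Computable.snd.comp Computable.fst)
    refine Computable.cond (hE.comp ?_) (Computable.const 1) (Computable.const 0)
    have hs : Computable fun y : ((ℕ × ℕ) × α) × ℕ => y.1.1 := Computable.fst.comp Computable.fst
    exact (Computable.fst.comp hs).pair ((Computable.snd.comp Computable.fst).pair
      ((Computable.succ.comp Computable.snd).pair (Computable.snd.comp hs)))
  have hcard : ∀ s T a, c ((s, T), a) =
      ((Finset.range T).filter fun i => E (s, (a, (i + 1, T))) = true).card := by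
    intro s T a
    simp only [c, Finset.card_filter, Bool.cond_eq_ite]
  have hle : ∀ (s T : ℕ) (a : α), (c ((s, T), a) : ℝ) ≤ ((T : ℝ) + 1) * φ a := by
    intro s T a
    rw [hcard]
    refine card_filter_le_of_succ_lt (mul_nonneg (by positivity) (h0 a)) fun i hi => ?_
    have := (ratVal_lt_iff _ _).1 ((hφE _).2 ⟨s, hi⟩)
    push_cast at this
    exact this
  have hge : ∀ (T : ℕ) (a : α), ∀ᶠ s in Filter.atTop, ((T : ℝ) + 1) * φ a - 1 ≤ c ((s, T), a) := by
    intro T a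
    have hev : ∀ᶠ s in Filter.atTop, ∀ i ∈ Finset.range T, (i : ℝ) + 1 < ((T : ℝ) + 1) * φ a →
        E (s, (a, (i + 1, T))) = true := by
      rw [Filter.eventually_all_finset]
      intro i _
      by_cases hi : (i : ℝ) + 1 < ((T : ℝ) + 1) * φ a
      · obtain ⟨s, hs⟩ := (hφE (a, (i + 1, T))).1
          ((ratVal_lt_iff _ _).2 (by push_cast; exact hi))
        filter_upwards [Filter.eventually_ge_atTop s] with t ht _
        exact hmono _ _ _ ht hs
      · exact Filter.Eventually.of_forall fun s hi' => absurd hi' hi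
    filter_upwards [hev] with s hs
    rw [hcard]
    refine le_card_filter_of_succ_lt ?_ fun i hi => hs i (Finset.mem_range.2 hi)
    have := h1 a
    nlinarith [(Nat.cast_nonneg T : (0 : ℝ) ≤ T)]
  have hdec : Computable fun x : (β × (ℕ × ℕ)) × ℕ =>
      decide (x.1.2.1 * (x.2.unpair.2 + 1) <
        (∑ j ∈ Finset.range (N x.1.1), c (x.2.unpair, h (x.1.1, j))) * (x.1.2.2 + 1)) := by
    have hu : Computable fun x : (β × (ℕ × ℕ)) × ℕ => x.2.unpair :=
      Computable.unpair.comp Computable.snd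
    have hb : Computable fun x : (β × (ℕ × ℕ)) × ℕ => x.1.1 := Computable.fst.comp Computable.fst
    have hq : Computable fun x : (β × (ℕ × ℕ)) × ℕ => x.1.2 := Computable.snd.comp Computable.fst
    have hsum : Computable fun x : (β × (ℕ × ℕ)) × ℕ =>
        ∑ j ∈ Finset.range (N x.1.1), c (x.2.unpair, h (x.1.1, j)) :=
      computable_sum_range (f := fun y : ((β × (ℕ × ℕ)) × ℕ) × ℕ =>
        c (y.1.2.unpair, h (y.1.1.1, y.2)))
        (hc.comp ((hu.comp Computable.fst).pair
          (hh.comp ((hb.comp Computable.fst).pair Computable.snd)))) (hN.comp hb)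
    exact Primrec.nat_lt.decide.to_comp.comp
      (Primrec.nat_mul.to_comp.comp (Computable.fst.comp hq)
        (Computable.succ.comp (Computable.snd.comp hu)))
      (Primrec.nat_mul.to_comp.comp hsum (Computable.succ.comp (Computable.snd.comp hq)))
  refine (rePred_exists_nat hdec).of_eq ?_
  rintro ⟨b, q⟩
  simp only [decide_eq_true_eq]
  rw [ratVal_lt_iff]
  set S := ∑ j ∈ Finset.range (N b), φ (h (b, j)) with hS
  have hq : (0 : ℝ) < (q.2 : ℝ) + 1 := by positivity
  constructor
  · rintro ⟨n, hn⟩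
    generalize n.unpair = u at hn
    have hn' : (q.1 : ℝ) * ((u.2 : ℝ) + 1) <
        (∑ j ∈ Finset.range (N b), (c (u, h (b, j)) : ℝ)) * ((q.2 : ℝ) + 1) := by
      exact_mod_cast hn
    have hsum : ∑ j ∈ Finset.range (N b), (c (u, h (b, j)) : ℝ) ≤ ((u.2 : ℝ) + 1) * S := by
      rw [hS, Finset.mul_sum]
      exact Finset.sum_le_sum fun j _ => hle u.1 u.2 _
    have h3 := hn'.trans_le (mul_le_mul_of_nonneg_right hsum hq.le)
    have hu : (0 : ℝ) < (u.2 : ℝ) + 1 := by positivity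
    by_contra hcon
    push Not at hcon
    nlinarith
  · intro hlt
    have hpos : 0 < ((q.2 : ℝ) + 1) * S - q.1 := sub_pos.2 hlt
    -- The `N b` counts lose at most `N b` in total, that is `N b / (T + 1)` after rescaling; this
    -- `T` makes the loss smaller than the gap between the sum and `q`.
    obtain ⟨T, hT⟩ := exists_nat_gt ((N b : ℝ) * ((q.2 : ℝ) + 1) / (((q.2 : ℝ) + 1) * S - q.1))
    have hev : ∀ᶠ s in Filter.atTop, ∀ j ∈ Finset.range (N b),
        ((T : ℝ) + 1) * φ (h (b, j)) - 1 ≤ c ((s, T), h (b, j)) :=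
      (Filter.eventually_all_finset _).2 fun j _ => hge T _
    obtain ⟨s, hs⟩ := hev.exists
    refine ⟨Nat.pair s T, ?_⟩
    rw [Nat.unpair_pair]
    have hsum : ((T : ℝ) + 1) * S - N b ≤ ∑ j ∈ Finset.range (N b), (c ((s, T), h (b, j)) : ℝ) := by
      have := Finset.sum_le_sum hs
      rw [Finset.sum_sub_distrib, ← Finset.mul_sum] at this
      simpa using this
    have hn' : (q.1 : ℝ) * ((T : ℝ) + 1) <
        (∑ j ∈ Finset.range (N b), (c ((s, T), h (b, j)) : ℝ)) * ((q.2 : ℝ) + 1) := by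
      rw [div_lt_iff₀ hpos] at hT
      have := mul_le_mul_of_nonneg_right hsum hq.le
      nlinarith
    exact_mod_cast hn'


/-! ### Clopen points of the compactified natural numbers -/

/-- The point closest to `n` is `n + 1`, at distance `1 / (n + 1) - 1 / (n + 2)`. This isolation
radius makes both the indicator and the singleton of `n` available as basic objects. -/
theorem le_dist_coe {n : ℕ} {y : NBar} (hy : y ≠ n) :
    1 / (((n : ℝ) + 1) * ((n : ℝ) + 2)) ≤ dist y n := by
  rw [dist_eq, toReal_coe]
  have hsub : ∀ a : ℝ, 0 ≤ a → 1 / (a + 1) - 1 / (a + 2) = 1 / ((a + 1) * (a + 2)) := by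
    intro a ha
    have h1 : a + 1 ≠ 0 := by positivity
    have h2 : a + 2 ≠ 0 := by positivity
    field_simp
    ring
  have hn : (0 : ℝ) ≤ n := n.cast_nonneg
  induction y using OnePoint.rec with
  | infty =>
    rw [toReal_infty, zero_sub, abs_neg, abs_of_pos (by positivity), ← hsub n hn]
    have : (0 : ℝ) < 1 / ((n : ℝ) + 2) := by positivity
    linarith
  | coe m =>
    have hm : (0 : ℝ) ≤ m := m.cast_nonneg
    rw [toReal_coe]
    rcases lt_trichotomy m n with h | h | h
    · have hmn : (m : ℝ) + 1 ≤ n := by exact_mod_cast h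
      have h2 : 1 / ((n : ℝ) + 1) ≤ 1 / ((m : ℝ) + 2) :=
        one_div_le_one_div_of_le (by positivity) (by linarith)
      have h3 : 1 / (((n : ℝ) + 1) * ((n : ℝ) + 2)) ≤ 1 / (((m : ℝ) + 1) * ((m : ℝ) + 2)) :=
        one_div_le_one_div_of_le (by positivity) (by gcongr)
      have := hsub m hm
      exact le_trans (by linarith) (le_abs_self _)
    · exact absurd (congrArg _ h) hy
    · have hmn : (n : ℝ) + 1 ≤ m := by exact_mod_cast h
      have h2 : 1 / ((m : ℝ) + 1) ≤ 1 / ((n : ℝ) + 2) :=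
        one_div_le_one_div_of_le (by positivity) (by linarith)
      have := hsub n hn
      exact le_trans (by linarith) (neg_le_abs _)

/-- Code of a hat function that is the indicator function of the point `n`. -/
def pointHat (n : ℕ) : ℕ × (ℕ × ℕ) × ℕ := (n, (0, 0), (n + 1) * (n + 2))

theorem primrec_pointHat : Primrec pointHat :=
  Primrec.id.pair ((Primrec.const (0, 0)).pair (Primrec.nat_mul.comp Primrec.succ
    (Primrec.succ.comp Primrec.succ)))

open Classical in
-- The width `1 / ((n + 1) * (n + 2) + 1)` is smaller than the isolation radius of `n`, so the hat
-- has already dropped to `0` at every other point.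
theorem hat_pointHat (n : ℕ) (y : NBar) :
    hat nbar (pointHat n) y = if y = n then 1 else 0 := by
  have hpos : (0 : ℝ) < ((n : ℝ) + 1) * ((n : ℝ) + 2) := by positivity
  have h0 : ratVal (0, 0) = 0 := by simp [ratVal]
  simp only [hat, pointHat, nbar, h0, sub_zero, max_eq_right (dist_nonneg (x := y))]
  split_ifs with h
  · simp [h]
  · have h1 := le_dist_coe h
    have h2 : (1 : ℝ) ≤ dist y n / (1 / ((((n + 1) * (n + 2) : ℕ) : ℝ) + 1)) := by
      rw [le_div_iff₀ (by positivity), one_mul]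
      refine le_trans (one_div_le_one_div_of_le hpos ?_) h1
      push_cast
      linarith
    exact max_eq_left (by linarith)

theorem hatMax_pointHat (l : List ℕ) (y : NBar) :
    hatMax nbar (l.map pointHat) y =
      Set.indicator ((fun n : ℕ => (n : NBar)) '' {n | n ∈ l}) (fun _ => (1 : ℝ)) y := by
  classical
  induction l with
  | nil => simp [hatMax]
  | cons n l ih =>
    have : hatMax nbar ((n :: l).map pointHat) y =
        max (hat nbar (pointHat n) y) (hatMax nbar (l.map pointHat) y) := rfl
    rw [this, ih, hat_pointHat]
    simp only [Set.indicator_apply, Set.mem_image, Set.mem_ofPred_eq, List.mem_cons]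
    by_cases h1 : y = n
    · have h2 : ∃ x, (x = n ∨ x ∈ l) ∧ (x : NBar) = y := ⟨n, Or.inl rfl, h1.symm⟩
      rw [if_pos h1, if_pos h2]
      split_ifs <;> simp
    · rw [if_neg h1]
      by_cases h2 : ∃ x, x ∈ l ∧ (x : NBar) = y
      · obtain ⟨x, hx, hxy⟩ := h2
        rw [if_pos ⟨x, hx, hxy⟩, if_pos ⟨x, Or.inr hx, hxy⟩]
        simp
      · have h3 : ¬ ∃ x, (x = n ∨ x ∈ l) ∧ (x : NBar) = y := by
          rintro ⟨x, rfl | hx, hxy⟩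
          · exact h1 hxy.symm
          · exact h2 ⟨x, hx, hxy⟩
        rw [if_neg h2, if_neg h3]
        simp

instance : Countable NBar := inferInstanceAs (Countable (Option ℕ))

theorem integral_hatMax_pointHat (l : List ℕ) (μ : ProbabilityMeasure NBar) :
    ∫ y, hatMax nbar (l.map pointHat) y ∂(μ : Measure NBar) =
      ∑ n ∈ l.toFinset, (μ : Measure NBar).real {(n : NBar)} := by
  classical
  simp_rw [hatMax_pointHat]
  rw [integral_indicator_const _ (Set.to_countable _).measurableSet, smul_eq_mul, mul_one]
  have h : (fun n : ℕ => (n : NBar)) '' {n | n ∈ l} =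
      (l.toFinset.image fun n : ℕ => (n : NBar) : Finset NBar) := by
    ext y; simp
  rw [h, ← sum_measureReal_singleton, Finset.sum_image fun a _ b _ hab => OnePoint.coe_injective hab]

theorem ball_coe_eq (n : ℕ) :
    Metric.ball (n : NBar) (ratVal (1, (n + 1) * (n + 2))) = {(n : NBar)} := by
  ext y
  rw [Metric.mem_ball, Set.mem_singleton_iff]
  constructor
  · intro h
    by_contra hy
    have h1 := le_dist_coe hy
    have h2 : ratVal (1, (n + 1) * (n + 2)) ≤ 1 / (((n : ℝ) + 1) * ((n : ℝ) + 2)) := by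
      unfold ratVal
      push_cast
      exact one_div_le_one_div_of_le (by positivity) (by linarith)
    linarith
  · rintro rfl
    rw [dist_self, ratVal]
    positivity

/-! ### Tests given by recursively enumerable searches -/

section SearchTest

variable {ι : Type*} [Primcodable ι]

/-- The function with value at least `2 ^ w i` at `(pt i, μ)` whenever `R i` holds and `μ` lies in
the basic open set with code `C i`. -/
def searchTest (R : ι → Prop) (pt : ι → ℕ) (C : ι → List SubbasisCode) (w : ι → ℕ)
    (x : NBar) (μ : ProbabilityMeasure NBar) : ℝ≥0∞ :=
  ⨆ (i : ι) (_ : R i ∧ x = pt i ∧ ∀ s ∈ C i, μ ∈ subbasicSet nbar s), (2 : ℝ≥0∞) ^ w i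

variable {R : ι → Prop} {pt : ι → ℕ} {C : ι → List SubbasisCode} {w : ι → ℕ}

/-- A supremum exceeds `q` exactly when one of its terms does, and each term lives on the product of
a singleton, which is a rational ball, with a finite intersection of subbasic sets. Enumerating the
`i` with `R i` and `q < 2 ^ w i` therefore suffices. -/
theorem lowerSemicomputable_searchTest (hR : REPred R) (hpt : Computable pt) (hC : Computable C)
    (hw : Primrec w) : LowerSemicomputable nbar (searchTest R pt C w) := by
  let B : ι → BasisCode := fun i => ((pt i, (1, (pt i + 1) * (pt i + 2))), C i)
  have hB : Computable B := by
    refine (hpt.pair ((Computable.const 1).pair (Primrec.nat_mul.to_comp.comp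
      (Computable.succ.comp hpt) (Computable.succ.comp (Computable.succ.comp hpt))))).pair hC
  refine ⟨fun p => ∃ i, R i ∧ B i = p.1 ∧ p.2.1 < 2 ^ w i * (p.2.2 + 1), ?_, ?_⟩
  · refine rePred_exists (p := fun y : (BasisCode × (ℕ × ℕ)) × ι =>
      R y.2 ∧ B y.2 = y.1.1 ∧ y.1.2.1 < 2 ^ w y.2 * (y.1.2.2 + 1))
      (rePred_and (rePred_comp hR Computable.snd) (rePred_and ?_ ?_))
    · classical
      refine ComputablePred.to_re (Computable.computablePred ?_)
      exact Primrec.eq.decide.to_comp.comp (hB.comp Computable.snd)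
        (Computable.fst.comp Computable.fst)
    · refine ComputablePred.to_re (Computable.computablePred ?_)
      have hq : Primrec fun y : (BasisCode × (ℕ × ℕ)) × ι => y.1.2 := Primrec.snd.comp Primrec.fst
      exact (Primrec.nat_lt.decide.comp (Primrec.fst.comp hq)
        (Primrec.nat_mul.comp (primrec_pow 2 (hw.comp Primrec.snd))
          (Primrec.succ.comp (Primrec.snd.comp hq)))).to_comp
  · intro q x μ
    have hval : ∀ i, ENNReal.ofReal (ratVal q) < 2 ^ w i ↔ q.1 < 2 ^ w i * (q.2 + 1) := by
      intro i
      have h2 : (2 : ℝ≥0∞) ^ w i = ENNReal.ofReal (2 ^ w i) := by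
        rw [ENNReal.ofReal_pow (by norm_num), ENNReal.ofReal_ofNat]
      rw [h2, ENNReal.ofReal_lt_ofReal_iff (by positivity), ratVal_lt_iff, mul_comm]
      exact_mod_cast Iff.rfl
    simp only [searchTest, lt_iSup_iff, hval]
    constructor
    · rintro ⟨i, ⟨hRi, hx, hμ⟩, hi⟩
      refine ⟨B i, ⟨i, hRi, rfl, hi⟩, ?_, hμ⟩
      have := ball_coe_eq (pt i)
      exact this.symm ▸ hx
    · rintro ⟨_, ⟨i, hRi, rfl, hi⟩, hx, hμ⟩
      exact ⟨i, ⟨hRi, (ball_coe_eq (pt i)).subset hx, hμ⟩, hi⟩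

open Classical in
-- The supremum is bounded by the sum of its terms, which is integrated term by term.
theorem lintegral_searchTest_le (μ : ProbabilityMeasure NBar) :
    ∫⁻ x, searchTest R pt C w x μ ∂(μ : Measure NBar) ≤
      ∑' i, if R i ∧ ∀ s ∈ C i, μ ∈ subbasicSet nbar s then
        (2 : ℝ≥0∞) ^ w i * (μ : Measure NBar) {(pt i : NBar)} else 0 := by
  have hle : ∀ x, searchTest R pt C w x μ ≤ ∑' i,
      Set.indicator {(pt i : NBar)} (fun _ => if R i ∧ ∀ s ∈ C i, μ ∈ subbasicSet nbar s then
        (2 : ℝ≥0∞) ^ w i else 0) x := by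
    intro x
    refine iSup_le fun i => iSup_le fun h => le_trans (le_of_eq ?_) (ENNReal.le_tsum i)
    rw [h.2.1, Set.indicator_of_mem (Set.mem_singleton _), if_pos ⟨h.1, h.2.2⟩]
  refine (lintegral_mono hle).trans (le_of_eq ?_)
  rw [lintegral_tsum fun i =>
    (measurable_const.indicator (measurableSet_singleton _)).aemeasurable]
  refine tsum_congr fun i => ?_
  rw [lintegral_indicator_const (measurableSet_singleton _), ite_mul, zero_mul]

end SearchTest

/-! ### From searches to tests unbounded at a given measure -/

/-- Since `4 / (4 ^ (k + 2) + 1) < 4 ^ (-(k + 1))`, the `k`-th term is at most `2 ^ (-(k + 1))`. -/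
theorem tsum_two_pow_mul_le :
    ∑' k : ℕ, (2 : ℝ≥0∞) ^ k * ENNReal.ofReal (ratVal (4, 4 ^ (k + 2))) ≤ 1 := by
  have h : ∀ k : ℕ, (2 : ℝ≥0∞) ^ k * ENNReal.ofReal (ratVal (4, 4 ^ (k + 2))) ≤
      (2⁻¹ : ℝ≥0∞) ^ (k + 1) := by
    intro k
    have e1 : (2 : ℝ≥0∞) ^ k = ENNReal.ofReal (2 ^ k) := by
      rw [ENNReal.ofReal_pow (by norm_num), ENNReal.ofReal_ofNat]
    have e2 : (2⁻¹ : ℝ≥0∞) ^ (k + 1) = ENNReal.ofReal ((2⁻¹) ^ (k + 1)) := by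
      rw [ENNReal.ofReal_pow (by norm_num), ENNReal.ofReal_inv_of_pos (by norm_num),
        ENNReal.ofReal_ofNat]
    rw [e1, e2, ← ENNReal.ofReal_mul (by positivity)]
    refine ENNReal.ofReal_le_ofReal ?_
    unfold ratVal
    push_cast
    rw [inv_pow, ← one_div, mul_div_assoc', div_le_div_iff₀ (by positivity) (by positivity)]
    have h4 : (4 : ℝ) ^ (k + 2) = 16 * (2 ^ k * 2 ^ k) := by
      rw [pow_add, ← mul_pow]; norm_num; ring
    have h2 : (0 : ℝ) < 2 ^ k := by positivity
    rw [h4, pow_succ]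
    nlinarith
  refine (ENNReal.tsum_le_tsum h).trans (le_of_eq ?_)
  rw [ENNReal.tsum_geometric_add_one, ENNReal.one_sub_inv_two, inv_inv]
  exact ENNReal.inv_mul_cancel (by norm_num) (by norm_num)

open Classical in
-- Here `k` is the level and `j` ranges over the searches made at that level. The bound `hbound`,
-- needed at every `μ`, pays for the weight `2 ^ k`; `hν` says that each level succeeds at `ν`, so
-- `g` reaches `2 ^ k` there for every `k`.
theorem exists_test_of_search {κ : Type*} [Primcodable κ] {R : ℕ × κ → Prop} {pt : ℕ × κ → ℕ}
    {C : ℕ × κ → List SubbasisCode} (hR : REPred R) (hpt : Computable pt) (hC : Computable C)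
    (hbound : ∀ (μ : ProbabilityMeasure NBar) (k : ℕ),
      ∑' j, (if R (k, j) ∧ ∀ s ∈ C (k, j), μ ∈ subbasicSet nbar s then
        (μ : Measure NBar) {(pt (k, j) : NBar)} else 0) ≤ ENNReal.ofReal (ratVal (4, 4 ^ (k + 2))))
    (ν : ProbabilityMeasure NBar)
    (hν : ∀ k, ∃ j, R (k, j) ∧ ∀ s ∈ C (k, j), ν ∈ subbasicSet nbar s) :
    ∃ g : NBar → ProbabilityMeasure NBar → ℝ≥0∞, IsUniformTest nbar g ∧
      ⨆ n : ℕ, g (n : NBar) ν = ⊤ := by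
  refine ⟨searchTest R pt C Prod.fst,
    ⟨lowerSemicomputable_searchTest hR hpt hC Primrec.fst, fun μ => ?_⟩, ?_⟩
  · refine (lintegral_searchTest_le μ).trans ?_
    rw [ENNReal.tsum_prod']
    refine le_trans (ENNReal.tsum_le_tsum fun k => ?_) tsum_two_pow_mul_le
    refine le_trans (le_of_eq ?_) (mul_le_mul_right (hbound μ k) (2 ^ k))
    rw [← ENNReal.tsum_mul_left]
    exact tsum_congr fun j => by rw [mul_ite, mul_zero]
  · rw [iSup_eq_top]
    intro b hb
    obtain ⟨k, hk⟩ := ENNReal.exists_nat_gt hb.ne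
    obtain ⟨j, hj, hjs⟩ := hν k
    refine ⟨pt (k, j), hk.trans_le (le_trans ?_
      (le_iSup₂_of_le (k, j) ⟨hj, rfl, hjs⟩ le_rfl))⟩
    exact_mod_cast Nat.lt_two_pow_self.le


theorem mem_subbasicSet_lt (μ : ProbabilityMeasure NBar) (l : List ℕ) (r : ℕ × ℕ) :
    μ ∈ subbasicSet nbar (true, l.map pointHat, r) ↔
      ∑ n ∈ l.toFinset, (μ : Measure NBar).real {(n : NBar)} < ratVal r := by
  rw [← integral_hatMax_pointHat]
  exact Iff.rfl

theorem mem_subbasicSet_gt (μ : ProbabilityMeasure NBar) (l : List ℕ) (r : ℕ × ℕ) :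
    μ ∈ subbasicSet nbar (false, l.map pointHat, r) ↔
      ratVal r < ∑ n ∈ l.toFinset, (μ : Measure NBar).real {(n : NBar)} := by
  rw [← integral_hatMax_pointHat]
  exact Iff.rfl

/-- Pigeonhole: `D + 2` points of mass at least `1 / (D + 1)` would have total mass greater than
`1`. -/
theorem exists_measureReal_singleton_lt (ν : ProbabilityMeasure NBar) (D : ℕ) :
    ∃ n < D + 2, (ν : Measure NBar).real {(n : NBar)} < ratVal (1, D) := by
  by_contra! h
  have h1 : ∑ n ∈ (List.range (D + 2)).toFinset, (ν : Measure NBar).real {(n : NBar)} ≤ 1 := by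
    classical
    rw [← Finset.sum_image (f := fun y => (ν : Measure NBar).real {y})
      fun a _ b _ hab => OnePoint.coe_injective hab, sum_measureReal_singleton]
    exact measureReal_le_one
  have h2 : ∑ _n ∈ Finset.range (D + 2), ratVal (1, D) ≤ 1 := by
    rw [List.toFinset_range] at h1
    exact (Finset.sum_le_sum fun n hn => h n (Finset.mem_range.1 hn)).trans h1
  rw [Finset.sum_const, Finset.card_range, nsmul_eq_mul, ratVal, mul_div_assoc',
    div_le_iff₀ (by positivity)] at h2
  push_cast at h2
  linarith

theorem tsum_ite_le_of_unique {P : ℕ → Prop} [DecidablePred P] {v : ℕ → ℝ≥0∞} {c : ℝ≥0∞}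
    (hP : ∀ m n, P m → P n → m = n) (hv : ∀ n, P n → v n ≤ c) :
    ∑' n, (if P n then v n else 0) ≤ c := by
  by_cases h : ∃ n, P n
  · obtain ⟨n, hn⟩ := h
    rw [tsum_eq_single n fun m hm => if_neg fun hPm => hm (hP m n hPm hn), if_pos hn]
    exact hv n hn
  · push Not at h
    simp [h]

theorem measure_le_ofReal {μ : ProbabilityMeasure NBar} {s : Set NBar} {r : ℝ}
    (h : (μ : Measure NBar).real s ≤ r) : (μ : Measure NBar) s ≤ ENNReal.ofReal r := by
  rw [← ofReal_measureReal]
  exact ENNReal.ofReal_le_ofReal h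

/-! ### Upper semicomputable measures -/

theorem exists_test_of_upperSemicomputable {ν : ProbabilityMeasure NBar}
    (hν : UpperSemicomputableOnNat ν) :
    ∃ g : NBar → ProbabilityMeasure NBar → ℝ≥0∞, IsUniformTest nbar g ∧
      ⨆ n : ℕ, g (n : NBar) ν = ⊤ := by
  have hD : Primrec fun x : ℕ × ℕ => 4 ^ (x.1 + 2) :=
    primrec_pow 4 (Primrec.nat_add.comp Primrec.fst (Primrec.const 2))
  obtain ⟨R, hR, hRp, huniq, hex⟩ := exists_uniformization
    (rePred_comp hν (Primrec.snd.pair ((Primrec.const 1).pair hD)).to_comp)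
  have hC : Primrec fun x : ℕ × ℕ =>
      [((true, [x.2].map pointHat, (1, 4 ^ (x.1 + 2))) : SubbasisCode)] :=
    Primrec.list_cons.comp ((Primrec.const true).pair
      ((Primrec.list_cons.comp (primrec_pointHat.comp Primrec.snd) (Primrec.const [])).pair
        ((Primrec.const 1).pair hD))) (Primrec.const [])
  classical
  refine exists_test_of_search (pt := Prod.snd) hR Computable.snd hC.to_comp
    (fun μ k => ?_) ν fun k => ?_
  · refine tsum_ite_le_of_unique (fun m n hm hn => huniq k m n hm.1 hn.1) fun n hn => ?_
    have h := (mem_subbasicSet_lt μ [n] _).1 (hn.2 _ (List.mem_singleton_self _))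
    refine measure_le_ofReal ?_
    rw [List.toFinset_cons, List.toFinset_nil, insert_empty_eq, Finset.sum_singleton] at h
    -- The mass is in fact below `ε`; the budget `4ε` is what the lower semicomputable case needs.
    refine h.le.trans ?_
    unfold ratVal
    gcongr
    norm_num
  · obtain ⟨n, -, hn⟩ := exists_measureReal_singleton_lt ν (4 ^ (k + 2))
    obtain ⟨m, hm⟩ := hex k n hn
    refine ⟨m, hm, fun s hs => ?_⟩
    rw [List.mem_singleton.1 hs, mem_subbasicSet_lt]
    simpa using hRp _ hm

/-! ### Lower semicomputable measures -/

/-- Codes of the conditions `μ {n} < 2ε`, `(m - 1) ε < μ {0, …, N - 1} < (m + 1) ε` for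
`ε = 1 / (D + 1)` and `N = D + 2`. -/
def windowCodes (D m n : ℕ) : List SubbasisCode :=
  (true, [n].map pointHat, (2, D)) :: (true, (List.range (D + 2)).map pointHat, (m + 1, D)) ::
    (List.range m).map fun j => (false, (List.range (D + 2)).map pointHat, (j, D))

/-- The lower end is imposed through all `i < m` and not only `i = m - 1`, so that `m = 0` imposes
nothing and truncated subtraction does no harm. -/
theorem mem_windowCodes_iff {μ : ProbabilityMeasure NBar} {D m n : ℕ} :
    (∀ s ∈ windowCodes D m n, μ ∈ subbasicSet nbar s) ↔
      (μ : Measure NBar).real {(n : NBar)} < ratVal (2, D) ∧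
      ∑ j ∈ Finset.range (D + 2), (μ : Measure NBar).real {(j : NBar)} < ratVal (m + 1, D) ∧
      ∀ i < m, ratVal (i, D) < ∑ j ∈ Finset.range (D + 2), (μ : Measure NBar).real {(j : NBar)} := by
  simp only [windowCodes, List.forall_mem_cons, List.forall_mem_map, mem_subbasicSet_lt,
    mem_subbasicSet_gt, List.toFinset_range, List.mem_range, List.toFinset_cons, List.toFinset_nil,
    insert_empty_eq, Finset.sum_singleton]

theorem primrec_windowCodes {α : Type*} [Primcodable α] {D m n : α → ℕ} (hD : Primrec D)
    (hm : Primrec m) (hn : Primrec n) : Primrec fun a => windowCodes (D a) (m a) (n a) := by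
  have hl : Primrec fun a => (List.range (D a + 2)).map pointHat :=
    Primrec.list_map (Primrec.list_range.comp (Primrec.succ.comp (Primrec.succ.comp hD)))
      (primrec_pointHat.comp Primrec.snd).to₂
  have h1 : Primrec fun a => ((true, [n a].map pointHat, (2, D a)) : SubbasisCode) :=
    (Primrec.const true).pair ((Primrec.list_cons.comp (primrec_pointHat.comp hn)
      (Primrec.const [])).pair ((Primrec.const 2).pair hD))
  have h2 : Primrec fun a =>
      ((true, (List.range (D a + 2)).map pointHat, (m a + 1, D a)) : SubbasisCode) :=
    (Primrec.const true).pair (hl.pair ((Primrec.succ.comp hm).pair hD))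
  have h3 : Primrec fun a => (List.range (m a)).map fun j =>
      ((false, (List.range (D a + 2)).map pointHat, (j, D a)) : SubbasisCode) :=
    Primrec.list_map (Primrec.list_range.comp hm) ((Primrec.const false).pair
      ((hl.comp Primrec.fst).pair (Primrec.snd.pair (hD.comp Primrec.fst)))).to₂
  exact Primrec.list_cons.comp h1 (Primrec.list_cons.comp h2 h3)

/-- A real number lies in at most two consecutive windows `((m - 1) ε, (m + 1) ε)`. -/
theorem window_subset {D m : ℕ} {y : ℝ} (hlt : y < ratVal (m + 1, D))
    (hgt : ∀ i < m, ratVal (i, D) < y) :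
    m ∈ ({⌊((D : ℝ) + 1) * y⌋₊, ⌊((D : ℝ) + 1) * y⌋₊ + 1} : Finset ℕ) := by
  rw [lt_ratVal_iff] at hlt
  push_cast at hlt
  have h1 : ⌊((D : ℝ) + 1) * y⌋₊ < m + 1 :=
    (Nat.floor_lt' (Nat.succ_ne_zero m)).2 (by push_cast; exact hlt)
  have h2 : m ≤ ⌊((D : ℝ) + 1) * y⌋₊ + 1 := by
    rcases m with _ | m
    · exact Nat.zero_le _
    · have := (ratVal_lt_iff _ _).1 (hgt m (Nat.lt_succ_self m))
      exact Nat.succ_le_succ (Nat.le_floor this.le)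
  rw [Finset.mem_insert, Finset.mem_singleton]
  omega

theorem sum_range_ite_ne {D n : ℕ} (hn : n < D) (f : ℕ → ℝ) :
    ∑ j ∈ Finset.range D, (if j = n then 0 else f j) = ∑ j ∈ Finset.range D, f j - f n := by
  rw [← Finset.add_sum_erase _ f (Finset.mem_range.2 hn),
    ← Finset.add_sum_erase _ _ (Finset.mem_range.2 hn), if_pos rfl, zero_add, add_sub_cancel_left]
  exact Finset.sum_congr rfl fun j hj => if_neg (Finset.ne_of_mem_erase hj)

/-- The difference between a total mass and `ν(n)` has no evident approximation from below; written
as the sum of the other masses, it does. -/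
theorem rePred_lt_sum_ite_ne {ν : ProbabilityMeasure NBar} (hν : LowerSemicomputableOnNat ν) :
    REPred fun p : (ℕ × ℕ) × (ℕ × ℕ) => ratVal p.2 < ∑ j ∈ Finset.range p.1.1,
      if j = p.1.2 then 0 else (ν : Measure NBar).real {(j : NBar)} := by
  have hφ : REPred fun p : (ℕ × ℕ) × (ℕ × ℕ) => ratVal p.2 <
      if p.1.2 = p.1.1 then 0 else (ν : Measure NBar).real {(p.1.2 : NBar)} := by
    have hne : REPred fun p : (ℕ × ℕ) × (ℕ × ℕ) => ¬ p.1.2 = p.1.1 :=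
      (PrimrecPred.computablePred (Primrec.eq.comp (Primrec.snd.comp Primrec.fst)
        (Primrec.fst.comp Primrec.fst))).not.to_re
    refine (rePred_and hne (rePred_comp hν
      ((Computable.snd.comp Computable.fst).pair Computable.snd))).of_eq fun p => ?_
    split_ifs with h
    · simp [h, (ratVal_nonneg p.2).not_gt]
    · simp [h]
  refine rePred_ratVal_lt_sum (φ := fun a : ℕ × ℕ =>
    if a.2 = a.1 then 0 else (ν : Measure NBar).real {(a.2 : NBar)}) (fun a => ?_) (fun a => ?_)
    hφ (h := fun x : (ℕ × ℕ) × ℕ => (x.1.2, x.2))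
    ((Computable.snd.comp Computable.fst).pair Computable.snd) Computable.fst
  · split_ifs
    exacts [le_rfl, measureReal_nonneg]
  · split_ifs
    exacts [zero_le_one, measureReal_le_one]

theorem exists_test_of_lowerSemicomputable {ν : ProbabilityMeasure NBar}
    (hν : LowerSemicomputableOnNat ν) :
    ∃ g : NBar → ProbabilityMeasure NBar → ℝ≥0∞, IsUniformTest nbar g ∧
      ⨆ n : ℕ, g (n : NBar) ν = ⊤ := by
  obtain ⟨D, hD, hDk⟩ : ∃ D : ℕ → ℕ, Primrec D ∧ ∀ k, 4 ^ (k + 2) = D k :=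
    ⟨_, primrec_pow 4 (Primrec.nat_add.comp Primrec.id (Primrec.const 2)), fun _ => rfl⟩
  have hDx : Primrec fun x : (ℕ × ℕ) × ℕ => D x.1.1 :=
    hD.comp (Primrec.fst.comp Primrec.fst)
  have hm : Primrec fun x : (ℕ × ℕ) × ℕ => x.1.2 := Primrec.snd.comp Primrec.fst
  -- The search at level `k` with guess `m`. For `m = 0` every `n < N` is accepted: the whole mass
  -- of the first `N` points is then below `ε`.
  have hp : REPred fun x : (ℕ × ℕ) × ℕ => x.2 < D x.1.1 + 2 ∧ (x.1.2 = 0 ∨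
      ratVal (x.1.2 - 1, D x.1.1) < ∑ j ∈ Finset.range (D x.1.1 + 2),
        if j = x.2 then 0 else (ν : Measure NBar).real {(j : NBar)}) := by
    have hN : Primrec fun x : (ℕ × ℕ) × ℕ => D x.1.1 + 2 :=
      Primrec.succ.comp (Primrec.succ.comp hDx)
    refine rePred_and (PrimrecPred.computablePred (Primrec.nat_lt.comp Primrec.snd hN)).to_re
      (rePred_or (PrimrecPred.computablePred (Primrec.eq.comp hm (Primrec.const 0))).to_re ?_)
    exact rePred_comp (f := fun x : (ℕ × ℕ) × ℕ => ((D x.1.1 + 2, x.2), (x.1.2 - 1, D x.1.1)))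
      (rePred_lt_sum_ite_ne hν)
      ((hN.pair Primrec.snd).pair ((Primrec.pred.comp hm).pair hDx)).to_comp
  obtain ⟨R, hR, hRp, huniq, hex⟩ := exists_uniformization hp
  have hassoc : Primrec fun x : ℕ × (ℕ × ℕ) => ((x.1, x.2.1), x.2.2) :=
    (Primrec.fst.pair (Primrec.fst.comp Primrec.snd)).pair (Primrec.snd.comp Primrec.snd)
  refine exists_test_of_search (R := fun x : ℕ × (ℕ × ℕ) => R ((x.1, x.2.1), x.2.2))
    (pt := fun x => x.2.2) (C := fun x => windowCodes (D x.1) x.2.1 x.2.2)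
    (rePred_comp hR hassoc.to_comp) (Primrec.snd.comp Primrec.snd).to_comp
    (primrec_windowCodes (hD.comp Primrec.fst) (Primrec.fst.comp Primrec.snd)
      (Primrec.snd.comp Primrec.snd)).to_comp (fun μ k => ?_) ν fun k => ?_
  · classical
    simp only [mem_windowCodes_iff, hDk]
    set y := ∑ j ∈ Finset.range (D k + 2), (μ : Measure NBar).real {(j : NBar)}
    set F : Finset ℕ := {⌊((D k : ℝ) + 1) * y⌋₊, ⌊((D k : ℝ) + 1) * y⌋₊ + 1}
    rw [ENNReal.tsum_prod']
    -- Only the two guesses in `F` can be active at `μ`, and each contributes at most one point, of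
    -- mass below `2ε`.
    calc _ ≤ ∑' m, if m ∈ F then ENNReal.ofReal (ratVal (2, D k)) else 0 := by
          refine ENNReal.tsum_le_tsum fun m => ?_
          split_ifs with hmF
          · exact tsum_ite_le_of_unique (fun a b ha hb => huniq _ a b ha.1 hb.1)
              fun n hn => measure_le_ofReal hn.2.1.le
          · refine le_of_eq (ENNReal.tsum_eq_zero.2 fun n => if_neg fun h => hmF ?_)
            exact window_subset h.2.2.1 h.2.2.2
      _ = ∑ m ∈ F, ENNReal.ofReal (ratVal (2, D k)) := by
          rw [tsum_eq_sum (s := F) fun m hm => if_neg hm]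
          exact Finset.sum_congr rfl fun m hm => if_pos hm
      _ = ENNReal.ofReal (ratVal (4, D k)) := by
          rw [Finset.sum_const, Finset.card_pair (Nat.succ_ne_self _).symm, two_nsmul,
            ← ENNReal.ofReal_add (ratVal_nonneg _) (ratVal_nonneg _), ratVal, ratVal]
          congr 1
          push_cast
          ring
  · set y := ∑ j ∈ Finset.range (D k + 2), (ν : Measure NBar).real {(j : NBar)} with hy
    have hy0 : 0 ≤ y := Finset.sum_nonneg fun _ _ => measureReal_nonneg
    have hD0 : (0 : ℝ) < (D k : ℝ) + 1 := by positivity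
    set m := ⌊((D k : ℝ) + 1) * y⌋₊
    have hmle : (m : ℝ) ≤ ((D k : ℝ) + 1) * y := Nat.floor_le (by positivity)
    have hmlt : ((D k : ℝ) + 1) * y < m + 1 := Nat.lt_floor_add_one _
    obtain ⟨n₀, hn₀, hn₀'⟩ := exists_measureReal_singleton_lt ν (D k)
    rw [lt_ratVal_iff] at hn₀'
    -- The search succeeds for the true `m`: since `m ε ≤ y` and `ν(n₀) < ε`, the points other than
    -- `n₀` have mass above `(m - 1) ε`. The `n` returned may differ from `n₀`.
    obtain ⟨n, hn⟩ := hex (k, m) n₀ ⟨hn₀, by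
      rcases Nat.eq_zero_or_pos m with h | h
      · exact Or.inl h
      · right
        rw [sum_range_ite_ne hn₀, ratVal_lt_iff]
        push_cast [Nat.cast_sub h] at hn₀' ⊢
        linarith⟩
    refine ⟨(m, n), hn, mem_windowCodes_iff.2 ⟨?_, ?_, fun i hi => ?_⟩⟩
    -- For `m > 0`, `ν(n)` is `y` minus the mass of the others, hence less than `(m + 1) ε - (m - 1)
    -- ε = 2ε`. For `m = 0`, `ν(n) ≤ y < ε`.
    · obtain ⟨hnN, h⟩ := hRp _ hn
      dsimp only at hnN h
      rw [lt_ratVal_iff]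
      rw [sum_range_ite_ne hnN, ratVal_lt_iff, ← hy] at h
      push_cast
      rcases Nat.eq_zero_or_pos m with h0 | h0
      · have : (ν : Measure NBar).real {(n : NBar)} ≤ y :=
          Finset.single_le_sum (f := fun j : ℕ => (ν : Measure NBar).real {(j : NBar)})
            (fun _ _ => measureReal_nonneg) (Finset.mem_range.2 hnN)
        rw [h0, Nat.cast_zero] at hmlt
        nlinarith
      · have h := h.resolve_left h0.ne'
        push_cast [Nat.cast_sub h0] at h
        linarith
    · rw [lt_ratVal_iff]
      push_cast
      exact hmlt
    · rw [ratVal_lt_iff]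
      have : (i : ℝ) < m := by exact_mod_cast hi
      exact this.trans_le hmle

/-! ### Unbounded tests exclude neutrality -/

theorem not_isNeutral_of_iSup_eq_top {t g : NBar → ProbabilityMeasure NBar → ℝ≥0∞}
    (ht : IsUniversalUniformTest nbar t) (hg : IsUniformTest nbar g) {ν : ProbabilityMeasure NBar}
    (hgν : ⨆ n : ℕ, g (n : NBar) ν = ⊤) : ¬ IsNeutral t ν := by
  intro hν
  obtain ⟨c, -, hc⟩ := ht.2 g hg
  have h : ⨆ n : ℕ, g (n : NBar) ν ≤ c :=
    iSup_le fun n => (hc n ν).trans (mul_le_of_le_one_right' (hν n))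
  exact ENNReal.coe_ne_top (top_le_iff.1 (hgν ▸ h))

end UniformTest
end

open UniformTest in
theorem mainTheorem12 :
    (∀ t : NBar → ProbabilityMeasure NBar → ℝ≥0∞, IsUniversalUniformTest nbar t →
      (¬ ∃ ν : ProbabilityMeasure NBar, IsNeutral t ν ∧ UpperSemicomputableOnNat ν) ∧
      (¬ ∃ ν : ProbabilityMeasure NBar, IsNeutral t ν ∧ LowerSemicomputableOnNat ν)) ∧
    (∀ ν : ProbabilityMeasure NBar, UpperSemicomputableOnNat ν ∨ LowerSemicomputableOnNat ν →
      ∃ g : NBar → ProbabilityMeasure NBar → ℝ≥0∞, IsUniformTest nbar g ∧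
        ⨆ n : ℕ, g (n : NBar) ν = ⊤) := by
  refine ⟨fun t ht => ⟨?_, ?_⟩, fun ν hν => hν.elim exists_test_of_upperSemicomputable
    exists_test_of_lowerSemicomputable⟩
  · rintro ⟨ν, hneutral, hν⟩
    obtain ⟨g, hg, hgν⟩ := exists_test_of_upperSemicomputable hν
    exact not_isNeutral_of_iSup_eq_top ht hg hgν hneutral
  · rintro ⟨ν, hneutral, hν⟩
    obtain ⟨g, hg, hgν⟩ := exists_test_of_lowerSemicomputable hν
    exact not_isNeutral_of_iSup_eq_top ht hg hgν hneutral
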